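/- Let $q$ be a prime power, let $n\ge 2$ with $(n,q)\neq(2,2)$, and let $V$ be a vector space of dimension $n+1$ over $\mathbb F_q$. Let $\Gamma=(\mathcal P,\mathcal L)$ be the point-hyperplane geometry of $\mathrm{PG}(V)$. Its points are the pairs $(p,H)$ where $p$ is a point and $H$ a hyperplane of $\mathrm{PG}(V)$ with $p\in H$. Its lines are the sets $\ell_{r,H}=\{(p,H): p\in r\}$, for a line $r$ of $\mathrm{PG}(V)$ contained in a hyperplane $H$, and the sets $\ell_{p,S}=\{(p,H): S\subseteq H\}$, for a subspace $S$ of $\mathrm{PG}(V)$ of codimension $2$ and a point $p\in S$. Let $W$ be a vector space over a field $K$ and let $\varepsilon\colon\Gamma\to\mathrm{PG}(W)$ be any projective embedding, that is, an injective map from $\mathcal P$ to the set of points of $\mathrm{PG}(W)$ whose image spans $\mathrm{PG}(W)$ and which maps every line of $\Gamma$ onto a line of $\mathrm{PG}(W)$. For each point $\omega$ of $\Omega=\varepsilon(\mathcal P)$ choose a non-zero vector $v_\omega\in W$ representing it, and let $$\mathcal C(\varepsilon(\Gamma))=\{(\varphi(v_\omega))_{\omega\in\Omega} : \varphi\in W^*\}\subseteq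 K^{\Omega}$$ be the linear code of the projective system $\Omega$ (the row space of a matrix whose columns are the coordinate vectors of the $v_\omega$). Then, for every choice of the $v_\omega$, the code $\mathcal C(\varepsilon(\Gamma))$ is minimal: if $c,c'\in\mathcal C(\varepsilon(\Gamma))$ and $\mathrm{supp}(c')\subseteq\mathrm{supp}(c)$, then $c'=\lambda c$ for some $\lambda\in K$. -/

import Mathlib

open scoped LinearAlgebra.Projectivization

/-- A point-line geometry with point set `P`: the lines are sets of points, every line has at
least two points, and two distinct points are on at most one common line. -/
structure PointLineGeometry (P : Type*) where
  lines : Set (Set P)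
  nonempty : Nonempty P
  two_le : ∀ l ∈ lines, l.Nontrivial
  unique_line : ∀ l ∈ lines, ∀ m ∈ lines, ∀ x y : P,
    x ≠ y → x ∈ l → y ∈ l → x ∈ m → y ∈ m → l = m

/-- The set of points of `PG(W)` contained in the linear subspace `L` of `W`. -/
def projPoints {K W : Type*} [Field K] [AddCommGroup W] [Module K W] (L : Submodule K W) :
    Set (ℙ K W) :=
  {x | x.submodule ≤ L}

/-- A projective embedding of `Γ` in `PG(W)`: an injective map from the points of `Γ` to the
points of `PG(W)` whose image spans `PG(W)` and which maps each line of `Γ` onto a projective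
line. -/
structure ProjectiveEmbedding {P : Type*} (Γ : PointLineGeometry P) (K W : Type*) [Field K]
    [AddCommGroup W] [Module K W] where
  toFun : P → ℙ K W
  injective : Function.Injective toFun
  spans : ⨆ p, (toFun p).submodule = ⊤
  map_line : ∀ l ∈ Γ.lines, ∃ L : Submodule K W,
    Module.finrank K L = 2 ∧ toFun '' l = projPoints L

/-- `v` chooses for every point of `Ω` a non-zero vector representing it. -/
def IsRepresentativeSystem {K W : Type*} [Field K] [AddCommGroup W] [Module K W]
    (Ω : Set (ℙ K W)) (v : Ω → W) : Prop :=
  ∀ ω : Ω, ∃ h : v ω ≠ 0, Projectivization.mk K (v ω) h = ω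

/-- The linear code of the projective system `Ω`, with coordinate positions indexed by `Ω`, and
with respect to the representative vectors `v`. Its words are the evaluations of the linear forms
of `W` at the representatives, so it is the row space of the matrix that has the coordinate
vectors of the representatives as columns. -/
def projectiveCode {K W : Type*} [Field K] [AddCommGroup W] [Module K W]
    (Ω : Set (ℙ K W)) (v : Ω → W) : Submodule K (Ω → K) :=
  LinearMap.range (LinearMap.pi fun ω : Ω => Module.Dual.eval K W (v ω))

/-- The codeword `c` of `C` is minimal: each word of `C` whose support lies in that of `c` is a
scalar multiple of `c`. -/
def IsMinimalCodeword {ι K : Type*} [Field K] (C : Submodule K (ι → K)) (c : ι → K) : Prop :=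
  ∀ c' ∈ C, Function.support c' ⊆ Function.support c → ∃ a : K, c' = a • c

/-- A code is minimal if all its codewords are minimal. -/
def IsMinimalCode {ι K : Type*} [Field K] (C : Submodule K (ι → K)) : Prop :=
  ∀ c ∈ C, IsMinimalCodeword C c

/-- The incident point-hyperplane pairs of `PG(V)`. -/
@[ext]
structure PointHyperplanePair (F V : Type*) [Field F] [AddCommGroup V] [Module F V] where
  point : ℙ F V
  hyperplane : Submodule F V
  codim : Module.finrank F (V ⧸ hyperplane) = 1
  incident : point.submodule ≤ hyperplane

namespace PointHyperplane

variable {F V : Type*} [Field F] [AddCommGroup V] [Module F V]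

/-- All pairs `(p, H)` with `p` on the line `r` of `PG(V)`; here `r` is contained in `H`. -/
def lineOfLine (r H : Submodule F V) : Set (PointHyperplanePair F V) :=
  {x | x.point.submodule ≤ r ∧ x.hyperplane = H}

/-- All pairs `(p, H)` with `H` containing `S`; here `S` has codimension two and contains `p`. -/
def lineOfCodimTwo (p : ℙ F V) (S : Submodule F V) : Set (PointHyperplanePair F V) :=
  {x | x.point = p ∧ S ≤ x.hyperplane}

/-- The lines of the point-hyperplane geometry of `PG(V)`. -/
def lines (F V : Type*) [Field F] [AddCommGroup V] [Module F V] :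
    Set (Set (PointHyperplanePair F V)) :=
  {l | ∃ r H : Submodule F V, Module.finrank F r = 2 ∧ Module.finrank F (V ⧸ H) = 1 ∧
      r ≤ H ∧ l = lineOfLine r H} ∪
  {l | ∃ (p : ℙ F V) (S : Submodule F V), Module.finrank F (V ⧸ S) = 2 ∧
      p.submodule ≤ S ∧ l = lineOfCodimTwo p S}

theorem exists_two_points {r : Submodule F V} (hr : Module.finrank F r = 2) :
    ∃ p q : ℙ F V, p ≠ q ∧ p.submodule ≤ r ∧ q.submodule ≤ r := by
  have : Module.Finite F r := Module.finite_of_finrank_eq_succ hr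
  let b := Module.finBasisOfFinrankEq F r hr
  have h0 : ((b 0 : r) : V) ≠ 0 := by simpa using b.ne_zero 0
  have h1 : ((b 1 : r) : V) ≠ 0 := by simpa using b.ne_zero 1
  refine ⟨.mk F _ h0, .mk F _ h1, ?_, ?_, ?_⟩
  · intro h
    rw [Projectivization.mk_eq_mk_iff'] at h
    obtain ⟨a, ha⟩ := h
    have h2 : a • b 1 = b 0 := Subtype.ext ha
    have h3 := congrArg (fun z => b.repr z 0) h2
    simp at h3
  · simp [Projectivization.submodule_mk]
  · simp [Projectivization.submodule_mk]

theorem eq_of_two_points {r : Submodule F V} (hr : Module.finrank F r = 2) {p q : ℙ F V}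
    (hpq : p ≠ q) (hp : p.submodule ≤ r) (hq : q.submodule ≤ r) :
    r = p.submodule ⊔ q.submodule := by
  have : Module.Finite F r := Module.finite_of_finrank_eq_succ hr
  symm
  apply Submodule.eq_of_le_of_finrank_le (sup_le hp hq)
  rw [hr]
  by_contra! hlt
  have e1 : p.submodule = p.submodule ⊔ q.submodule := by
    have : Module.Finite F ↥(p.submodule ⊔ q.submodule) :=
      Submodule.finiteDimensional_of_le (sup_le hp hq)
    apply Submodule.eq_of_le_of_finrank_le le_sup_left
    rw [Projectivization.finrank_submodule]
    omega
  have e2 : q.submodule = p.submodule ⊔ q.submodule := by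
    have : Module.Finite F ↥(p.submodule ⊔ q.submodule) :=
      Submodule.finiteDimensional_of_le (sup_le hp hq)
    apply Submodule.eq_of_le_of_finrank_le le_sup_right
    rw [Projectivization.finrank_submodule]
    omega
  exact hpq (Projectivization.submodule_injective (e1.trans e2.symm))

/-- The codimension of a larger subspace, computed in the quotient by the smaller one. -/
theorem finrank_map_mkQ {S H : Submodule F V} [Module.Finite F (V ⧸ S)] (h : S ≤ H) :
    Module.finrank F (V ⧸ H) + Module.finrank F (H.map S.mkQ) = Module.finrank F (V ⧸ S) := by
  rw [← (Submodule.quotientQuotientEquivQuotient S H h).finrank_eq]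
  exact Submodule.finrank_quotient_add_finrank _

theorem exists_two_hyperplanes {S : Submodule F V} (hS : Module.finrank F (V ⧸ S) = 2) :
    ∃ H H' : Submodule F V, H ≠ H' ∧ Module.finrank F (V ⧸ H) = 1 ∧
      Module.finrank F (V ⧸ H') = 1 ∧ S ≤ H ∧ S ≤ H' := by
  have : Module.Finite F (V ⧸ S) := Module.finite_of_finrank_eq_succ hS
  have hT : Module.finrank F (⊤ : Submodule F (V ⧸ S)) = 2 := by simpa using hS
  obtain ⟨p, q, hpq, -, -⟩ := exists_two_points hT
  have key (p : ℙ F (V ⧸ S)) :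
      Module.finrank F (V ⧸ p.submodule.comap S.mkQ) = 1 ∧ S ≤ p.submodule.comap S.mkQ := by
    have hle : S ≤ p.submodule.comap S.mkQ := by
      intro x hx
      simp [(Submodule.Quotient.mk_eq_zero S).2 hx]
    have h := finrank_map_mkQ hle
    rw [Submodule.map_comap_eq_of_surjective S.mkQ_surjective,
      Projectivization.finrank_submodule] at h
    exact ⟨by omega, hle⟩
  refine ⟨_, _, fun h => hpq ?_, (key p).1, (key q).1, (key p).2, (key q).2⟩
  exact Projectivization.submodule_injective
    (Submodule.comap_injective_of_surjective S.mkQ_surjective h)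

theorem eq_of_two_hyperplanes {S : Submodule F V} (hS : Module.finrank F (V ⧸ S) = 2)
    {H H' : Submodule F V} (hne : H ≠ H') (hH : Module.finrank F (V ⧸ H) = 1)
    (hH' : Module.finrank F (V ⧸ H') = 1) (h : S ≤ H) (h' : S ≤ H') : S = H ⊓ H' := by
  have : Module.Finite F (V ⧸ S) := Module.finite_of_finrank_eq_succ hS
  have d1 := finrank_map_mkQ h
  have d2 := finrank_map_mkQ h'
  have d := finrank_map_mkQ (le_inf h h')
  have back {A : Submodule F V} (hA : S ≤ A) : (A.map S.mkQ).comap S.mkQ = A := by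
    rw [Submodule.comap_map_eq, Submodule.ker_mkQ, sup_eq_left.2 hA]
  have hle1 : (H ⊓ H').map S.mkQ ≤ H.map S.mkQ := Submodule.map_mono inf_le_left
  have hle2 : (H ⊓ H').map S.mkQ ≤ H'.map S.mkQ := Submodule.map_mono inf_le_right
  have hz : Module.finrank F ((H ⊓ H').map S.mkQ) = 0 := by
    by_contra hpos
    have e1 := Submodule.eq_of_le_of_finrank_le hle1 (by omega)
    have e2 := Submodule.eq_of_le_of_finrank_le hle2 (by omega)
    apply hne
    rw [← back h, ← back h', ← e1, ← e2]
  have hb := Submodule.finrank_eq_zero.1 hz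
  have hc := back (le_inf h h')
  rw [hb] at hc
  simpa using hc

theorem lines_nontrivial : ∀ l ∈ lines F V, l.Nontrivial := by
  rintro l (⟨r, H, hr, hH, hle, rfl⟩ | ⟨p, S, hS, hp, rfl⟩)
  · obtain ⟨p, q, hpq, hp, hq⟩ := exists_two_points hr
    exact ⟨⟨p, H, hH, hp.trans hle⟩, ⟨hp, rfl⟩, ⟨q, H, hH, hq.trans hle⟩, ⟨hq, rfl⟩,
      fun h => hpq (congrArg PointHyperplanePair.point h)⟩
  · obtain ⟨H, H', hne, hH, hH', h, h'⟩ := exists_two_hyperplanes hS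
    exact ⟨⟨p, H, hH, hp.trans h⟩, ⟨rfl, h⟩, ⟨p, H', hH', hp.trans h'⟩, ⟨rfl, h'⟩,
      fun e => hne (congrArg PointHyperplanePair.hyperplane e)⟩

theorem lines_unique : ∀ l ∈ lines F V, ∀ m ∈ lines F V, ∀ x y : PointHyperplanePair F V,
    x ≠ y → x ∈ l → y ∈ l → x ∈ m → y ∈ m → l = m := by
  rintro l (⟨r, H, hr, hH, hle, rfl⟩ | ⟨p, S, hS, hp, rfl⟩)
    m (⟨r', H', hr', hH', hle', rfl⟩ | ⟨p', S', hS', hp', rfl⟩) x y hxy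
    ⟨hx1, hx2⟩ ⟨hy1, hy2⟩ ⟨hx3, hx4⟩ ⟨hy3, hy4⟩
  · have hne : x.point ≠ y.point := fun h => hxy (PointHyperplanePair.ext h (hx2.trans hy2.symm))
    rw [eq_of_two_points hr hne hx1 hy1, eq_of_two_points hr' hne hx3 hy3, ← hx2, ← hx4]
  · exact absurd (PointHyperplanePair.ext (hx3.trans hy3.symm) (hx2.trans hy2.symm)) hxy
  · exact absurd (PointHyperplanePair.ext (hx1.trans hy1.symm) (hx4.trans hy4.symm)) hxy
  · have hne : x.hyperplane ≠ y.hyperplane :=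
      fun h => hxy (PointHyperplanePair.ext (hx1.trans hy1.symm) h)
    rw [eq_of_two_hyperplanes hS hne x.codim y.codim hx2 hy2,
      eq_of_two_hyperplanes hS' hne x.codim y.codim hx4 hy4, ← hx1, ← hx3]

theorem nonempty_pair (h : 2 ≤ Module.finrank F V) : Nonempty (PointHyperplanePair F V) := by
  have : Module.Finite F V := Module.finite_of_finrank_pos (by omega)
  let b := Module.finBasis F V
  let i : Fin (Module.finrank F V) := ⟨0, by omega⟩
  let j : Fin (Module.finrank F V) := ⟨1, by omega⟩
  have hij : j ≠ i := by simp [i, j, Fin.ext_iff]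
  refine ⟨⟨.mk F (b j) (b.ne_zero j), LinearMap.ker (b.coord i), ?_, ?_⟩⟩
  · have hs : Function.Surjective (b.coord i) := by
      intro a
      exact ⟨a • b i, by simp⟩
    rw [((b.coord i).quotKerEquivOfSurjective hs).finrank_eq, Module.finrank_self]
  · rw [Projectivization.submodule_mk, Submodule.span_singleton_le_iff_mem]
    simp [hij]

end PointHyperplane

/-- The point-hyperplane geometry of `PG(V)`, where `PG(V)` has projective dimension at least one
(so that there are incident point-hyperplane pairs). -/
def pointHyperplaneGeometry (F V : Type*) [Field F] [AddCommGroup V] [Module F V]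
    (h : 2 ≤ Module.finrank F V) : PointLineGeometry (PointHyperplanePair F V) where
  lines := PointHyperplane.lines F V
  nonempty := PointHyperplane.nonempty_pair h
  two_le := PointHyperplane.lines_nontrivial
  unique_line := PointHyperplane.lines_unique

/-! ### Connectedness of the complement of a geometric hyperplane -/

section Connectedness

variable {F V : Type*} [Field F] [AddCommGroup V] [Module F V]

/-! Let `φ` and `ψ` define the two words, so that `ψ` vanishes at every point of `Ω` where `φ` does.
The image of a line of the geometry is a full projective line, so it contains a zero of `φ`, which
is also a zero of `ψ`. Hence `ψ / φ` is constant on the points of the line outside the zeros of `φ`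
(`ratio_eq`). The words are therefore proportional once the complement of the zero set of `φ` is
connected under collinearity.

The zero set is a geometric hyperplane of the point-hyperplane geometry, encoded by vectors and
forms as `IsIncidenceHyperplane`; connectedness is `colour_eq`. Flags `(p, h)` and `(p', h')` off
the zero set are joined through a common point `w` of `ker h ⊓ ker h'` whenever some `w` is off the
zero set with both forms. The remaining case, `colour_eq_of_inf_le`, replaces `w` by a form through
a point of each kernel and ends with a three-against-two pigeonhole. It needs at least three vectors
in `ker h ⊓ ker h'`, which is what excluding `(n, q) = (2, 2)` provides. -/

theorem exists_smul_eq_of_ker_le {h h' : Module.Dual F V} (h0 : h ≠ 0)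
    (hle : ∀ y, h' y = 0 → h y = 0) : ∃ c : F, h' = c • h := by
  obtain ⟨x, hx⟩ : ∃ x, h x ≠ 0 := by
    by_contra! hcon
    exact h0 (LinearMap.ext hcon)
  have hx' : h' x ≠ 0 := fun h1 => hx (hle x h1)
  refine ⟨h' x / h x, LinearMap.ext fun u => ?_⟩
  -- The projection of `u` along `x` lies in `ker h'`, hence in `ker h`.
  have h1 := hle (u - (h' u / h' x) • x) (by simp [*])
  simp only [map_sub, map_smul, smul_eq_mul, sub_eq_zero] at h1
  simp only [LinearMap.smul_apply, smul_eq_mul, h1]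
  field_simp

/-- A binary relation between vectors and linear forms such that the vectors related to a form
make up a subspace of codimension at most one in its kernel, and the forms related to a vector
make up a subspace of its annihilator. -/
structure IsIncidenceHyperplane (Z : V → Module.Dual F V → Prop) : Prop where
  zero_right : ∀ u, Z u 0
  comb_left : ∀ (ξ : Module.Dual F V) (u v : V) (a b : F), ξ u = 0 → ξ v = 0 →
    Z u ξ → Z v ξ → Z (a • u + b • v) ξ
  comb_right : ∀ (u : V) (ξ η : Module.Dual F V) (a b : F), ξ u = 0 → η u = 0 →
    Z u ξ → Z u η → Z u (a • ξ + b • η)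
  meet : ∀ (ξ : Module.Dual F V) (u v : V), ξ u = 0 → ξ v = 0 →
    ∃ a b : F, (a ≠ 0 ∨ b ≠ 0) ∧ Z (a • u + b • v) ξ

namespace IsIncidenceHyperplane

variable {Z : V → Module.Dual F V → Prop}

theorem add_left (hZ : IsIncidenceHyperplane Z) {ξ : Module.Dual F V} {u v : V}
    (hu : ξ u = 0) (hv : ξ v = 0) (h1 : Z u ξ) (h2 : Z v ξ) : Z (u + v) ξ := by
  simpa using hZ.comb_left ξ u v 1 1 hu hv h1 h2

theorem sub_left (hZ : IsIncidenceHyperplane Z) {ξ : Module.Dual F V} {u v : V}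
    (hu : ξ u = 0) (hv : ξ v = 0) (h1 : Z u ξ) (h2 : Z v ξ) : Z (u - v) ξ := by
  simpa [sub_eq_add_neg] using hZ.comb_left ξ u v 1 (-1) hu hv h1 h2

theorem smul_left (hZ : IsIncidenceHyperplane Z) {ξ : Module.Dual F V} {u : V} (a : F)
    (hu : ξ u = 0) (h1 : Z u ξ) : Z (a • u) ξ := by
  simpa using hZ.comb_left ξ u u a 0 hu hu h1 h1

theorem sub_right (hZ : IsIncidenceHyperplane Z) {ξ η : Module.Dual F V} {u : V}
    (hu : ξ u = 0) (hv : η u = 0) (h1 : Z u ξ) (h2 : Z u η) : Z u (ξ - η) := by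
  convert hZ.comb_right u ξ η 1 (-1) hu hv h1 h2 using 1
  ext x
  simp [sub_eq_add_neg]

theorem smul_right (hZ : IsIncidenceHyperplane Z) {ξ : Module.Dual F V} {u : V} (a : F)
    (hu : ξ u = 0) (h1 : Z u ξ) : Z u (a • ξ) := by
  simpa using hZ.comb_right u ξ ξ a 0 hu hu h1 h1

/-- Two vectors that are each off `Z` for some common annihilating form are simultaneously so. -/
theorem exists_common_form (hZ : IsIncidenceHyperplane Z) {u v : V} {ξ η : Module.Dual F V}
    (hξu : ξ u = 0) (hξv : ξ v = 0) (hηu : η u = 0) (hηv : η v = 0) (h1 : ¬ Z u ξ)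
    (h2 : ¬ Z v η) : ∃ ζ : Module.Dual F V, ζ u = 0 ∧ ζ v = 0 ∧ ¬ Z u ζ ∧ ¬ Z v ζ := by
  by_cases h3 : Z v ξ
  · by_cases h4 : Z u η
    -- If `ξ` is off `Z` only at `u` and `η` only at `v`, their sum is off `Z` at both.
    · refine ⟨ξ + η, by simp [*], by simp [*], fun h => h1 ?_, fun h => h2 ?_⟩
      · simpa using hZ.sub_right (by simp [*]) hηu h h4
      · simpa using hZ.sub_right (by simp [*]) hξv h h3
    · exact ⟨η, hηu, hηv, h4, h2⟩
  · exact ⟨ξ, hξu, hξv, h1, h3⟩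

theorem exists_common_vector (hZ : IsIncidenceHyperplane Z) {u v : V} {ξ η : Module.Dual F V}
    (hξu : ξ u = 0) (hξv : ξ v = 0) (hηu : η u = 0) (hηv : η v = 0) (h1 : ¬ Z u ξ)
    (h2 : ¬ Z v η) : ∃ w : V, ξ w = 0 ∧ η w = 0 ∧ ¬ Z w ξ ∧ ¬ Z w η := by
  by_cases h3 : Z v ξ
  · by_cases h4 : Z u η
    · refine ⟨u + v, by simp [*], by simp [*], fun h => h1 ?_, fun h => h2 ?_⟩
      · simpa using hZ.sub_left (by simp [*]) hξv h h3
      · simpa using hZ.sub_left (by simp [*]) hηu h h4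
    · exact ⟨u, hξu, hηu, h1, h4⟩
  · exact ⟨v, hξv, hηv, h3, h2⟩

/-- If all forms annihilating `z` and one of two distinct vectors `y₁`, `y₂` are related to `z`,
then so is a form that takes the value one at both of these. -/
theorem of_forall_forall (hZ : IsIncidenceHyperplane Z) {h h' : Module.Dual F V} {z y₁ y₂ : V}
    (hz : h z = 0) (hz' : h' z = 1) (h1 : h y₁ = 1) (h2 : h y₂ = 1) (h1' : h' y₁ = 0)
    (h2' : h' y₂ = 0) (hne : y₁ ≠ y₂)
    (R1 : ∀ ξ : Module.Dual F V, ξ z = 0 → ξ y₁ = 0 → Z z ξ)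
    (R2 : ∀ ξ : Module.Dual F V, ξ z = 0 → ξ y₂ = 0 → Z z ξ) : Z z h := by
  have hw : y₁ - y₂ ∉ F ∙ z := by
    intro hmem
    obtain ⟨c, hc⟩ := Submodule.mem_span_singleton.1 hmem
    have := congrArg h' hc
    simp only [map_smul, hz', map_sub, h1', h2', smul_eq_mul, mul_one, sub_zero] at this
    rw [this, zero_smul] at hc
    exact hne (sub_eq_zero.1 hc.symm)
  obtain ⟨g, hg, hgz⟩ := Submodule.exists_le_ker_of_notMem hw
  have hgz : g z = 0 := hgz (Submodule.mem_span_singleton_self z)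
  -- Correcting `g` by multiples of `h` makes it vanish at `y₁` or at `y₂`; the difference of the
  -- two corrections is a non-zero multiple of `h`.
  have e1 := R1 (g - g y₁ • h) (by simp [*]) (by simp [*])
  have e2 := R2 (g - g y₂ • h) (by simp [*]) (by simp [*])
  have e := hZ.smul_right (-(g (y₁ - y₂))⁻¹) (by simp [*])
    (hZ.sub_right (by simp [*]) (by simp [*]) e1 e2)
  convert e using 1
  ext x
  have : g y₁ - g y₂ ≠ 0 := by simpa using hg
  simp
  field_simp
  ring

/-- In the kernel of `h'`, if all of `ker h ⊓ ker h'` is related to `h'`, then a vector outside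
is related to `h'` only if all vectors outside are. -/
theorem not_of_inf_le (hZ : IsIncidenceHyperplane Z) {h h' : Module.Dual F V} {p : V}
    (hp : h' p = 0) (hZp : ¬ Z p h') (hS : ∀ s, h s = 0 → h' s = 0 → Z s h') {y : V}
    (hy : h' y = 0) (hy1 : h y ≠ 0) : ¬ Z y h' := by
  intro hZy
  apply hZp
  have e := hZ.add_left (by simp [*]) (by simp [*]) (hZ.smul_left (h p / h y) hy hZy)
    (hS (p - (h p / h y) • y) (by simp [*]) (by simp [*]))
  simpa using e

/-- The slice `h = 1` of `ker h'` is a coset of `S = ker h ⊓ ker h'`. If `S` lies in `Z`, the slice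
avoids `Z`. Otherwise the slice contains some `b` in `Z`, and `b + s` is off `Z` for each `s` in `S`
off `Z`; as `S` has three elements, there are two such `s`. -/
theorem exists_two (hZ : IsIncidenceHyperplane Z) {h h' : Module.Dual F V}
    (hS : ∀ a, h a = 0 → h' a = 0 → ∃ b, h b = 0 ∧ h' b = 0 ∧ b ≠ 0 ∧ b ≠ a)
    {p y : V} (hp : h' p = 0) (hZp : ¬ Z p h') (hy : h' y = 0) (hy1 : h y = 1) :
    ∃ y₁ y₂ : V, y₁ ≠ y₂ ∧ h y₁ = 1 ∧ h y₂ = 1 ∧ h' y₁ = 0 ∧ h' y₂ = 0 ∧ ¬ Z y₁ h' ∧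
      ¬ Z y₂ h' := by
  by_cases hc : ∀ s, h s = 0 → h' s = 0 → Z s h'
  · obtain ⟨s, hs, hs', hs0, -⟩ := hS 0 (by simp) (by simp)
    exact ⟨y, y + s, by simpa using hs0, hy1, by simp [*], hy, by simp [*],
      hZ.not_of_inf_le hp hZp hc hy (by simp [*]),
      hZ.not_of_inf_le hp hZp hc (by simp [*]) (by simp [*])⟩
  push Not at hc
  obtain ⟨a, ha, ha', hZa⟩ := hc
  obtain ⟨b, hb', hb, hZb⟩ : ∃ b, h' b = 0 ∧ h b = 1 ∧ Z b h' := by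
    -- As `a` is off `Z`, the related combination involves `y`; dividing by `β` puts it on the
    -- slice.
    obtain ⟨α, β, hne, hZ1⟩ := hZ.meet h' a y ha' hy
    have hβ : β ≠ 0 := by
      rintro rfl
      have hα : α ≠ 0 := by simpa using hne
      apply hZa
      have := hZ.smul_left α⁻¹ (by simp [*]) hZ1
      simpa [smul_smul, hα] using this
    exact ⟨β⁻¹ • (α • a + β • y), by simp [*], by simp [*], hZ.smul_left _ (by simp [*]) hZ1⟩
  have key : ∀ s, h' s = 0 → ¬ Z s h' → ¬ Z (b + s) h' := by
    intro s hs hZs hZ1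
    apply hZs
    simpa using hZ.sub_left (by simp [*]) hb' hZ1 hZb
  obtain ⟨c, hc, hc', hc0, hca⟩ := hS a ha ha'
  by_cases hZc : Z c h'
  · refine ⟨b + a, b + (a + c), by simpa using hc0, by simp [*], by simp [*], by simp [*],
      by simp [*], key _ ha' hZa, key _ (by simp [*]) fun hZ1 => hZa ?_⟩
    simpa using hZ.sub_left (by simp [*]) hc' hZ1 hZc
  · exact ⟨b + a, b + c, by simpa using hca.symm, by simp [*], by simp [*], by simp [*],
      by simp [*], key _ ha' hZa, key _ hc' hZc⟩

theorem exists_three (hZ : IsIncidenceHyperplane Z) {h h' : Module.Dual F V}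
    (hS : ∀ a, h a = 0 → h' a = 0 → ∃ b, h b = 0 ∧ h' b = 0 ∧ b ≠ 0 ∧ b ≠ a)
    {p : V} (hp : h' p = 0) (hZp : ¬ Z p h') (hc : ∀ s, h s = 0 → h' s = 0 → Z s h') :
    ∃ z : Fin 3 → V, Function.Injective z ∧ ∀ i, h (z i) = 1 ∧ h' (z i) = 0 ∧ ¬ Z (z i) h' := by
  have hp1 : h p ≠ 0 := fun h0 => hZp (hc p h0 hp)
  obtain ⟨s, hs, hs', hs0, -⟩ := hS 0 (by simp) (by simp)
  obtain ⟨t, ht, ht', ht0, hts⟩ := hS s hs hs'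
  have key : ∀ r, h r = 0 → h' r = 0 → h ((h p)⁻¹ • p + r) = 1 ∧ h' ((h p)⁻¹ • p + r) = 0 ∧
      ¬ Z ((h p)⁻¹ • p + r) h' := fun r hr hr' =>
    ⟨by simp [*], by simp [*], hZ.not_of_inf_le hp hZp hc (by simp [*]) (by simp [*])⟩
  have hall : ∀ i, h ((![0, s, t] : Fin 3 → V) i) = 0 ∧ h' ((![0, s, t] : Fin 3 → V) i) = 0 := by
    intro i
    fin_cases i <;> simp [*]
  refine ⟨fun i => (h p)⁻¹ • p + (![0, s, t] : Fin 3 → V) i, ?_, fun i =>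
    key _ (hall i).1 (hall i).2⟩
  intro i j hij
  have hij : (![0, s, t] : Fin 3 → V) i = (![0, s, t] : Fin 3 → V) j := add_left_cancel hij
  have hs0' := hs0.symm
  have ht0' := ht0.symm
  have hts' := hts.symm
  fin_cases i <;> fin_cases j <;> simp_all

variable {α : Type*} {κ : V → Module.Dual F V → α}

/-- Take three vectors `z i` in `ker h` and two vectors `y₁`, `y₂` in `ker h'`, all off `Z` with
these forms. If no path joins the flags through `z i` and `y₁` or `y₂`, each such pair has a blocked
member: one related to all forms that kill both. By `of_forall_forall`, a vector blocked against two
partners would be related to `h` or `h'`. So each `z i` blocks some `y`, and one `y` is blocked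
twice. -/
theorem colour_eq_of_inf_le (hZ : IsIncidenceHyperplane Z)
    (hκl : ∀ (ξ : Module.Dual F V) (u v : V), ξ u = 0 → ξ v = 0 → ¬ Z u ξ → ¬ Z v ξ →
      κ u ξ = κ v ξ)
    (hκr : ∀ (u : V) (ξ η : Module.Dual F V), ξ u = 0 → η u = 0 → ¬ Z u ξ → ¬ Z u η →
      κ u ξ = κ u η)
    {h h' : Module.Dual F V}
    (hS : ∀ a, h a = 0 → h' a = 0 → ∃ b, h b = 0 ∧ h' b = 0 ∧ b ≠ 0 ∧ b ≠ a)
    {p p' y : V} (hp : h p = 0) (hp' : h' p' = 0) (hZp : ¬ Z p h) (hZp' : ¬ Z p' h')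
    (hy : h' y = 0) (hy1 : h y ≠ 0) (hc : ∀ s, h s = 0 → h' s = 0 → Z s h) :
    κ p h = κ p' h' := by
  by_contra hne
  obtain ⟨z, hzi, hz⟩ := hZ.exists_three (h := h') (h' := h)
    (fun a h1 h2 => by simpa only [and_left_comm] using hS a h2 h1) hp hZp
    (fun s h1 h2 => hc s h2 h1)
  obtain ⟨y₁, y₂, hy12, h1, h2, h1', h2', hZ1, hZ2⟩ := hZ.exists_two hS hp' hZp'
    (y := (h y)⁻¹ • y) (by simp [*]) (by simp [*])
  have pair : ∀ i y, h' y = 0 → ¬ Z y h' →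
      (∀ ξ : Module.Dual F V, ξ (z i) = 0 → ξ y = 0 → Z (z i) ξ) ∨
      (∀ ξ : Module.Dual F V, ξ y = 0 → ξ (z i) = 0 → Z y ξ) := by
    intro i y hy hZy
    by_contra! hcon
    obtain ⟨⟨ξ, a1, a2, a3⟩, η, b1, b2, b3⟩ := hcon
    obtain ⟨ζ, c1, c2, c3, c4⟩ := hZ.exists_common_form a1 a2 b2 b1 a3 b3
    obtain ⟨-, d2, d3⟩ := hz i
    -- The path is `(p, h)`, `(z i, h)`, `(z i, ζ)`, `(y, ζ)`, `(y, h')`, `(p', h')`.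
    exact hne (((hκl h p (z i) hp d2 hZp d3).trans (hκr (z i) h ζ d2 c1 d3 c3)).trans
      (((hκl ζ (z i) y c1 c2 c3 c4).trans (hκr y ζ h' c2 hy c4 hZy)).trans
        (hκl h' y p' hy hp' hZy hZp')))
  have alt : ∀ i, (∀ ξ : Module.Dual F V, ξ y₁ = 0 → ξ (z i) = 0 → Z y₁ ξ) ∨
      (∀ ξ : Module.Dual F V, ξ y₂ = 0 → ξ (z i) = 0 → Z y₂ ξ) := by
    intro i
    rcases pair i y₁ h1' hZ1 with e1 | e1
    · rcases pair i y₂ h2' hZ2 with e2 | e2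
      · exact absurd (hZ.of_forall_forall (hz i).2.1 (hz i).1 h1 h2 h1' h2' hy12 e1 e2)
          (hz i).2.2
      · exact .inr e2
    · exact .inl e1
  have once : ∀ i j, i ≠ j → ∀ y, h y = 1 → h' y = 0 → ¬ Z y h' →
      (∀ ξ : Module.Dual F V, ξ y = 0 → ξ (z i) = 0 → Z y ξ) →
      (∀ ξ : Module.Dual F V, ξ y = 0 → ξ (z j) = 0 → Z y ξ) → False :=
    fun i j hij y h1 h1' hZy e1 e2 => hZy (hZ.of_forall_forall h1' h1 (hz i).1 (hz j).1
      (hz i).2.1 (hz j).2.1 (hzi.ne hij) e1 e2)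
  -- Pigeonhole: two of the three indices select the same vector among `y₁`, `y₂`.
  rcases alt 0 with e0 | e0 <;> rcases alt 1 with e1 | e1 <;> rcases alt 2 with e2 | e2
  all_goals first
    | exact once 0 1 (by decide) _ h1 h1' hZ1 e0 e1
    | exact once 0 2 (by decide) _ h1 h1' hZ1 e0 e2
    | exact once 1 2 (by decide) _ h1 h1' hZ1 e1 e2
    | exact once 0 1 (by decide) _ h2 h2' hZ2 e0 e1
    | exact once 0 2 (by decide) _ h2 h2' hZ2 e0 e2
    | exact once 1 2 (by decide) _ h2 h2' hZ2 e1 e2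

theorem colour_eq_of_ker_le (hZ : IsIncidenceHyperplane Z)
    (hκl : ∀ (ξ : Module.Dual F V) (u v : V), ξ u = 0 → ξ v = 0 → ¬ Z u ξ → ¬ Z v ξ →
      κ u ξ = κ v ξ)
    (hκr : ∀ (u : V) (ξ η : Module.Dual F V), ξ u = 0 → η u = 0 → ¬ Z u ξ → ¬ Z u η →
      κ u ξ = κ u η)
    {h h' : Module.Dual F V} {p p' : V} (hp : h p = 0) (hp' : h' p' = 0) (hZp : ¬ Z p h)
    (hZp' : ¬ Z p' h') (hle : ∀ y, h' y = 0 → h y = 0) : κ p h = κ p' h' := by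
  have h0 : h ≠ 0 := by
    rintro rfl
    exact hZp (hZ.zero_right p)
  obtain ⟨c, rfl⟩ := exists_smul_eq_of_ker_le h0 hle
  have hZ1 : ¬ Z p' h := fun h1 => hZp' (hZ.smul_right _ (hle _ hp') h1)
  exact (hκl h p p' hp (hle _ hp') hZp hZ1).trans (hκr p' h _ (hle _ hp') hp' hZ1 hZp')

/-- The complement of the relation is connected: a colouring that is constant on the vectors
annihilated by a form and on the forms annihilating a vector is constant. -/
theorem colour_eq (hZ : IsIncidenceHyperplane Z)
    (hκl : ∀ (ξ : Module.Dual F V) (u v : V), ξ u = 0 → ξ v = 0 → ¬ Z u ξ → ¬ Z v ξ →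
      κ u ξ = κ v ξ)
    (hκr : ∀ (u : V) (ξ η : Module.Dual F V), ξ u = 0 → η u = 0 → ¬ Z u ξ → ¬ Z u η →
      κ u ξ = κ u η)
    (hS : ∀ (h h' : Module.Dual F V) (a : V), h a = 0 → h' a = 0 →
      ∃ b, h b = 0 ∧ h' b = 0 ∧ b ≠ 0 ∧ b ≠ a)
    {h h' : Module.Dual F V} {p p' : V} (hp : h p = 0) (hp' : h' p' = 0) (hZp : ¬ Z p h)
    (hZp' : ¬ Z p' h') : κ p h = κ p' h' := by
  by_cases h1 : ∀ y, h' y = 0 → h y = 0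
  · exact hZ.colour_eq_of_ker_le hκl hκr hp hp' hZp hZp' h1
  by_cases h2 : ∀ y, h y = 0 → h' y = 0
  · exact (hZ.colour_eq_of_ker_le hκl hκr hp' hp hZp' hZp h2).symm
  push Not at h1 h2
  obtain ⟨y, hy, hy1⟩ := h1
  obtain ⟨z, hz, hz1⟩ := h2
  by_cases hc : ∀ s, h s = 0 → h' s = 0 → Z s h
  · exact hZ.colour_eq_of_inf_le hκl hκr (hS h h') hp hp' hZp hZp' hy hy1 hc
  by_cases hc' : ∀ s, h' s = 0 → h s = 0 → Z s h'
  · exact (hZ.colour_eq_of_inf_le hκl hκr (hS h' h) hp' hp hZp' hZp hz hz1 hc').symm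
  push Not at hc hc'
  obtain ⟨s, s1, s2, s3⟩ := hc
  obtain ⟨t, t1, t2, t3⟩ := hc'
  -- Generic case: the path is `(p, h)`, `(w, h)`, `(w, h')`, `(p', h')`.
  obtain ⟨w, w1, w2, w3, w4⟩ := hZ.exists_common_vector s1 t2 s2 t1 s3 t3
  exact ((hκl h p w hp w1 hZp w3).trans (hκr w h h' w1 w2 w3 w4)).trans
    (hκl h' w p' w2 hp' w4 hZp')

end IsIncidenceHyperplane

/-- Two forms cut out a subspace of dimension at least `n - 1`, hence with at least `q ^ (n - 1)`
vectors; this exceeds two unless `n = q = 2`. -/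
theorem exists_mem_inf_ker_ne [Finite F] {n : ℕ} (hn : 2 ≤ n) (hV : Module.finrank F V = n + 1)
    (hex : ¬ (n = 2 ∧ Nat.card F = 2)) (h h' : Module.Dual F V) (a : V) :
    ∃ b, h b = 0 ∧ h' b = 0 ∧ b ≠ 0 ∧ b ≠ a := by
  have : Module.Finite F V := Module.finite_of_finrank_pos (by omega)
  have : Finite V := Module.finite_of_finite F
  by_contra! hcon
  let S : Submodule F V := LinearMap.ker (h.prod h')
  have hsub : (S : Set V) ⊆ {0, a} := by
    intro b hb
    have hb : h b = 0 ∧ h' b = 0 := by simpa [S] using hb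
    by_cases h0 : b = 0
    · exact .inl h0
    · exact .inr (hcon b hb.1 hb.2 h0)
  have hcard : Nat.card S ≤ 2 :=
    (Set.ncard_le_ncard hsub (Set.toFinite _)).trans ((Set.ncard_insert_le _ _).trans (by simp))
  have hdim : n ≤ Module.finrank F S + 1 := by
    have e1 := LinearMap.finrank_range_add_finrank_ker (h.prod h')
    have e2 := Submodule.finrank_le (LinearMap.range (h.prod h'))
    rw [Module.finrank_prod, Module.finrank_self] at e2
    simp only [S]
    omega
  rw [Module.natCard_eq_pow_finrank (K := F)] at hcard
  have hq : 2 ≤ Nat.card F := Finite.one_lt_card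
  by_cases hk : Module.finrank F S = 1
  · rw [hk, pow_one] at hcard
    exact hex ⟨by omega, by omega⟩
  · have := Nat.pow_le_pow_right (show 0 < Nat.card F by omega)
      (show 2 ≤ Module.finrank F S by omega)
    nlinarith

end Connectedness

/-! ### Linear forms on the lines of an embedded geometry -/

section Embedding

variable {P K W : Type*} [Field K] [AddCommGroup W] [Module K W] {Γ : PointLineGeometry P}

namespace ProjectiveEmbedding

variable (ε : ProjectiveEmbedding Γ K W) {f : P → W}
  (hf : ∀ x, ∃ h : f x ≠ 0, Projectivization.mk K (f x) h = ε.toFun x)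

include hf

theorem submodule_eq_span (x : P) : (ε.toFun x).submodule = K ∙ f x := by
  obtain ⟨h, e⟩ := hf x
  rw [← e, Projectivization.submodule_mk]

theorem linearIndependent_pair {x y : P} (hxy : x ≠ y) : LinearIndependent K ![f x, f y] := by
  obtain ⟨hx, ex⟩ := hf x
  obtain ⟨hy, ey⟩ := hf y
  rw [LinearIndependent.pair_iff' hx]
  intro a ha
  apply ε.injective.ne hxy.symm
  rw [← ex, ← ey, Projectivization.mk_eq_mk_iff']
  exact ⟨a, ha⟩

theorem exists_line {l : Set P} (hl : l ∈ Γ.lines) : ∃ L : Submodule K W,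
    Module.finrank K L = 2 ∧ (∀ x ∈ l, f x ∈ L) ∧
      ∀ w ∈ L, w ≠ 0 → ∃ z ∈ l, ∃ c : K, c • w = f z := by
  obtain ⟨L, hL, e⟩ := ε.map_line l hl
  refine ⟨L, hL, fun x hx => ?_, fun w hw h0 => ?_⟩
  · have h1 : ε.toFun x ∈ projPoints L := e ▸ Set.mem_image_of_mem _ hx
    rw [projPoints, Set.mem_ofPred_eq, ε.submodule_eq_span hf] at h1
    exact h1 (Submodule.mem_span_singleton_self _)
  · have h1 : Projectivization.mk K w h0 ∈ projPoints L := by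
      simpa [projPoints, Projectivization.submodule_mk] using hw
    rw [← e] at h1
    obtain ⟨z, hz, ez⟩ := h1
    obtain ⟨hz0, e1⟩ := hf z
    rw [← e1, Projectivization.mk_eq_mk_iff'] at ez
    exact ⟨z, hz, ez⟩

theorem mem_span_pair {l : Set P} (hl : l ∈ Γ.lines) {x y z : P} (hx : x ∈ l) (hy : y ∈ l)
    (hz : z ∈ l) (hxy : x ≠ y) : f z ∈ Submodule.span K {f x, f y} := by
  obtain ⟨L, hL, h1, -⟩ := ε.exists_line hf hl
  have : Module.Finite K L := Module.finite_of_finrank_eq_succ hL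
  have hle : Submodule.span K {f x, f y} ≤ L := by
    rw [Submodule.span_le, Set.pair_subset_iff]
    exact ⟨h1 x hx, h1 y hy⟩
  have e : Submodule.span K {f x, f y} = L := by
    apply Submodule.eq_of_le_of_finrank_le hle
    have := finrank_span_eq_card (ε.linearIndependent_pair hf hxy)
    rw [Matrix.range_cons_cons_empty, Fintype.card_fin] at this
    omega
  rw [e]
  exact h1 z hz

theorem apply_eq_zero_of_mem_line (φ : Module.Dual K W) {l : Set P} (hl : l ∈ Γ.lines) {x y z : P}
    (hx : x ∈ l) (hy : y ∈ l) (hz : z ∈ l) (hxy : x ≠ y) (h1 : φ (f x) = 0) (h2 : φ (f y) = 0) :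
    φ (f z) = 0 := by
  obtain ⟨a, b, e⟩ := Submodule.mem_span_pair.1 (ε.mem_span_pair hf hl hx hy hz hxy)
  simp [← e, h1, h2]

/-- The combination of `f x` and `f y` killed by `φ` is non-zero by independence, and it represents
a point of `l` because `l` maps onto the whole projective line. -/
theorem exists_zero_of_pair (φ : Module.Dual K W) {l : Set P} (hl : l ∈ Γ.lines) {x y : P}
    (hx : x ∈ l) (hy : y ∈ l) (hxy : x ≠ y) (h1 : φ (f x) ≠ 0) :
    ∃ z ∈ l, φ (f z) = 0 ∧ ∃ c : K, c • (φ (f y) • f x - φ (f x) • f y) = f z := by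
  obtain ⟨L, -, hL, hz⟩ := ε.exists_line hf hl
  obtain ⟨z, hzl, c, hc⟩ := hz (φ (f y) • f x - φ (f x) • f y)
    (L.sub_mem (L.smul_mem _ (hL x hx)) (L.smul_mem _ (hL y hy))) (by
      intro h0
      have := LinearIndependent.pair_iff.1 (ε.linearIndependent_pair hf hxy) (φ (f y))
        (-φ (f x)) (by rw [neg_smul, ← sub_eq_add_neg, h0])
      exact h1 (neg_eq_zero.1 this.2))
  refine ⟨z, hzl, ?_, c, hc⟩
  rw [← hc]
  simp [mul_comm]

theorem exists_zero (φ : Module.Dual K W) {l : Set P} (hl : l ∈ Γ.lines) :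
    ∃ z ∈ l, φ (f z) = 0 := by
  obtain ⟨x, hx, y, hy, hxy⟩ := Γ.two_le l hl
  by_cases h : φ (f x) = 0
  · exact ⟨x, hx, h⟩
  · obtain ⟨z, hz, e, -⟩ := ε.exists_zero_of_pair hf φ hl hx hy hxy h
    exact ⟨z, hz, e⟩

/-- If the zeros of `φ` are zeros of `ψ`, the ratio of `ψ` to `φ` is constant on a line. -/
theorem ratio_eq {φ ψ : Module.Dual K W} (h : ∀ x, φ (f x) = 0 → ψ (f x) = 0) {l : Set P}
    (hl : l ∈ Γ.lines) {x y : P} (hx : x ∈ l) (hy : y ∈ l) (h1 : φ (f x) ≠ 0)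
    (h2 : φ (f y) ≠ 0) : ψ (f x) / φ (f x) = ψ (f y) / φ (f y) := by
  by_cases hxy : x = y
  · rw [hxy]
  obtain ⟨z, -, hz, c, hc⟩ := ε.exists_zero_of_pair hf φ hl hx hy hxy h1
  have hc0 : c ≠ 0 := by
    rintro rfl
    obtain ⟨hz0, -⟩ := hf z
    exact hz0 (by simpa using hc.symm)
  have h3 := h z hz
  rw [← hc, map_smul, smul_eq_mul, mul_eq_zero, or_iff_right hc0] at h3
  simp only [map_sub, map_smul, smul_eq_mul, sub_eq_zero] at h3
  rw [div_eq_div_iff h1 h2]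
  linear_combination h3

end ProjectiveEmbedding

end Embedding

/-! ### Incident pairs and lines in terms of vectors and forms -/

section Flags

variable {F V : Type*} [Field F] [AddCommGroup V] [Module F V]

theorem finrank_quotient_ker_of_ne_zero {ξ : Module.Dual F V} (hξ : ξ ≠ 0) :
    Module.finrank F (V ⧸ LinearMap.ker ξ) = 1 := by
  rw [(ξ.quotKerEquivOfSurjective (LinearMap.surjective hξ)).finrank_eq, Module.finrank_self]

theorem exists_ker_eq_of_finrank_quotient {H : Submodule F V} (hH : Module.finrank F (V ⧸ H) = 1) :
    ∃ ξ : Module.Dual F V, ξ ≠ 0 ∧ LinearMap.ker ξ = H := by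
  have : Module.Finite F (V ⧸ H) := Module.finite_of_finrank_eq_succ hH
  let e : (V ⧸ H) ≃ₗ[F] F := LinearEquiv.ofFinrankEq _ _ (by rw [hH, Module.finrank_self])
  have hk : LinearMap.ker (e.toLinearMap ∘ₗ H.mkQ) = H := by
    rw [LinearEquiv.ker_comp, Submodule.ker_mkQ]
  refine ⟨e.toLinearMap ∘ₗ H.mkQ, fun h0 => ?_, hk⟩
  have e : H = ⊤ := by rw [← hk, h0, LinearMap.ker_zero]
  have : Subsingleton (V ⧸ H) := Submodule.Quotient.subsingleton_iff.2 e
  rw [Module.finrank_zero_of_subsingleton] at hH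
  exact zero_ne_one hH

theorem exists_ker_ne {ξ η : Module.Dual F V} (h : LinearIndependent F ![ξ, η]) :
    ∃ y, ξ y = 0 ∧ η y ≠ 0 := by
  by_contra! hcon
  obtain ⟨c, hc⟩ := exists_smul_eq_of_ker_le (h.ne_zero 1) hcon
  exact (LinearIndependent.pair_iff' (h.ne_zero 1)).1 (LinearIndependent.pair_symm_iff.1 h) c hc.symm

theorem finrank_quotient_inf_ker {ξ η : Module.Dual F V} (h : LinearIndependent F ![ξ, η]) :
    Module.finrank F (V ⧸ (LinearMap.ker ξ ⊓ LinearMap.ker η)) = 2 := by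
  rw [← LinearMap.ker_prod]
  have hs : Function.Surjective (ξ.prod η) := by
    obtain ⟨y, hy, hy1⟩ := exists_ker_ne h
    have h' : LinearIndependent F ![η, ξ] := LinearIndependent.pair_symm_iff.1 h
    obtain ⟨z, hz, hz1⟩ := exists_ker_ne h'
    rintro ⟨a, b⟩
    exact ⟨(a / ξ z) • z + (b / η y) • y, by simp [*]⟩
  rw [((ξ.prod η).quotKerEquivOfSurjective hs).finrank_eq, Module.finrank_prod,
    Module.finrank_self]

namespace PointHyperplanePair

/-- The incident pair of the point spanned by `x` and the kernel of `ξ`. -/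
def ofForm (x : V) (ξ : Module.Dual F V) (hx : x ≠ 0) (hξ : ξ ≠ 0) (h : ξ x = 0) :
    PointHyperplanePair F V where
  point := .mk F x hx
  hyperplane := LinearMap.ker ξ
  codim := finrank_quotient_ker_of_ne_zero hξ
  incident := by simpa [Projectivization.submodule_mk] using h

theorem exists_eq_ofForm (y : PointHyperplanePair F V) :
    ∃ x ξ, ∃ (hx : x ≠ 0) (hξ : ξ ≠ 0) (h : ξ x = 0), y = ofForm x ξ hx hξ h := by
  obtain ⟨p, H, hH, hp⟩ := y
  obtain ⟨ξ, hξ, rfl⟩ := exists_ker_eq_of_finrank_quotient hH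
  refine ⟨p.rep, ξ, p.rep_nonzero, hξ, hp ?_, ?_⟩
  · rw [Projectivization.submodule_eq]
    exact Submodule.mem_span_singleton_self _
  · ext1
    · simp [ofForm]
    · rfl

theorem ofForm_smul_left {x : V} {ξ : Module.Dual F V} {c : F} (hc : c ≠ 0) (hx : c • x ≠ 0)
    (hξ : ξ ≠ 0) (h : ξ (c • x) = 0) :
    ofForm (c • x) ξ hx hξ h = ofForm x ξ (right_ne_zero_of_smul hx) hξ
      (by simpa [hc] using h) := by
  ext1
  · exact (Projectivization.mk_eq_mk_iff' F _ _ _ _).2 ⟨c, rfl⟩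
  · rfl

theorem ofForm_smul_right {x : V} {ξ : Module.Dual F V} {c : F} (hc : c ≠ 0) (hx : x ≠ 0)
    (hξ : c • ξ ≠ 0) (h : (c • ξ) x = 0) :
    ofForm x (c • ξ) hx hξ h = ofForm x ξ hx (right_ne_zero_of_smul hξ)
      (by simpa [hc] using h) := by
  ext1
  · rfl
  · exact LinearMap.ker_smul ξ c hc

open PointHyperplane in
/-- The pairs with hyperplane `ker ξ` and point in the span of `u` and `v` make up a line. -/
theorem exists_line_left {ξ : Module.Dual F V} (hξ : ξ ≠ 0) {u v : V}
    (hu : ξ u = 0) (hv : ξ v = 0) (hind : LinearIndependent F ![u, v]) :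
    ∃ l ∈ lines F V, (∀ (a b : F) hx h, ofForm (a • u + b • v) ξ hx hξ h ∈ l) ∧
      ∀ z ∈ l, ∃ (a b : F), ∃ hx h, z = ofForm (a • u + b • v) ξ hx hξ h := by
  have hr : Module.finrank F (Submodule.span F {u, v}) = 2 := by
    have := finrank_span_eq_card hind
    rwa [Matrix.range_cons_cons_empty, Fintype.card_fin] at this
  have hle : Submodule.span F {u, v} ≤ LinearMap.ker ξ := by
    rw [Submodule.span_le, Set.pair_subset_iff]
    exact ⟨hu, hv⟩
  refine ⟨lineOfLine (Submodule.span F {u, v}) (LinearMap.ker ξ),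
    .inl ⟨_, _, hr, finrank_quotient_ker_of_ne_zero hξ, hle, rfl⟩, fun a b hx h => ⟨?_, rfl⟩, ?_⟩
  · simp only [ofForm, Projectivization.submodule_mk, Submodule.span_singleton_le_iff_mem]
    exact Submodule.mem_span_pair.2 ⟨a, b, rfl⟩
  · rintro ⟨p, H, hH, hp⟩ ⟨h1, rfl⟩
    have hmem : p.rep ∈ p.submodule := by
      rw [Projectivization.submodule_eq]
      exact Submodule.mem_span_singleton_self _
    obtain ⟨a, b, e⟩ := Submodule.mem_span_pair.1 (h1 hmem)
    refine ⟨a, b, e ▸ p.rep_nonzero, e ▸ hp hmem, ?_⟩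
    ext1
    · simp [ofForm, e]
    · rfl

open PointHyperplane in
theorem exists_line_right {u : V} (hu : u ≠ 0) {ξ η : Module.Dual F V}
    (hξ : ξ u = 0) (hη : η u = 0) (hind : LinearIndependent F ![ξ, η]) :
    ∃ l ∈ lines F V, ∀ (a b : F) hx h, ofForm u (a • ξ + b • η) hu hx h ∈ l := by
  refine ⟨lineOfCodimTwo (.mk F u hu) (LinearMap.ker ξ ⊓ LinearMap.ker η),
    .inr ⟨_, _, finrank_quotient_inf_ker hind, ?_, rfl⟩, fun a b hx h => ⟨rfl, ?_⟩⟩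
  · simp [Projectivization.submodule_mk, hξ, hη]
  · rintro x ⟨h1, h2⟩
    have h1 : ξ x = 0 := h1
    have h2 : η x = 0 := h2
    simp [ofForm, h1, h2]

theorem ofForm_ne_left {ξ : Module.Dual F V} (hξ : ξ ≠ 0) {u v : V} (hu : u ≠ 0) (hv : v ≠ 0)
    (h1 : ξ u = 0) (h2 : ξ v = 0) (hind : LinearIndependent F ![u, v]) :
    ofForm u ξ hu hξ h1 ≠ ofForm v ξ hv hξ h2 := by
  intro e
  obtain ⟨a, ha⟩ := (Projectivization.mk_eq_mk_iff' F _ _ hv hu).1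
    (congrArg PointHyperplanePair.point e).symm
  exact (LinearIndependent.pair_iff' hu).1 hind a ha

theorem ofForm_ne_right {u : V} (hu : u ≠ 0) {ξ η : Module.Dual F V} (hξ : ξ ≠ 0) (hη : η ≠ 0)
    (h1 : ξ u = 0) (h2 : η u = 0) (hind : LinearIndependent F ![ξ, η]) :
    ofForm u ξ hu hξ h1 ≠ ofForm u η hu hη h2 := by
  intro e
  have hk : LinearMap.ker ξ = LinearMap.ker η := congrArg PointHyperplanePair.hyperplane e
  obtain ⟨y, hy, hy1⟩ := exists_ker_ne hind
  exact hy1 (hk.le hy)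

end PointHyperplanePair

/-! ### Zero sets of linear forms and constancy of the ratio -/

namespace ProjectiveEmbedding

open PointHyperplanePair

variable {K W : Type*} [Field K] [AddCommGroup W] [Module K W] {h2 : 2 ≤ Module.finrank F V}
  (ε : ProjectiveEmbedding (pointHyperplaneGeometry F V h2) K W) {f : PointHyperplanePair F V → W}
  (hf : ∀ x, ∃ h : f x ≠ 0, Projectivization.mk K (f x) h = ε.toFun x)

include hf

/-- The zeros of a linear form make up a hyperplane of the point-hyperplane geometry. -/
theorem isIncidenceHyperplane (φ : Module.Dual K W) :
    IsIncidenceHyperplane fun (x : V) (ξ : Module.Dual F V) =>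
      ∀ hx hξ h, φ (f (ofForm x ξ hx hξ h)) = 0 where
  -- The relation holds vacuously for a zero vector, a zero form or a non-incident pair, so its
  -- failure always supplies a genuine flag.
  zero_right u := fun _ hξ => absurd rfl hξ
  comb_left ξ u v a b hu hv h1 h2 := by
    intro hx hξ h
    by_cases hu0 : u = 0
    · subst hu0
      have e : a • (0 : V) + b • v = b • v := by simp
      simp only [e] at hx ⊢
      rw [ofForm_smul_left (left_ne_zero_of_smul hx)]
      exact h2 _ hξ hv
    by_cases hind : LinearIndependent F ![u, v]
    · obtain ⟨l, hl, hmem, -⟩ := exists_line_left hξ hu hv hind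
      have hv0 : v ≠ 0 := hind.ne_zero 1
      refine ε.apply_eq_zero_of_mem_line hf φ hl (x := ofForm u ξ hu0 hξ hu)
        (y := ofForm v ξ hv0 hξ hv) ?_ ?_ (hmem a b hx h)
        (ofForm_ne_left hξ hu0 hv0 hu hv hind) (h1 _ _ _) (h2 _ _ _)
      · simpa using hmem 1 0 (by simpa using hu0) (by simpa using hu)
      · simpa using hmem 0 1 (by simpa using hv0) (by simpa using hv)
    · rw [LinearIndependent.pair_iff' hu0] at hind
      push Not at hind
      obtain ⟨c, rfl⟩ := hind
      have e : a • u + b • c • u = (a + b * c) • u := by rw [add_smul, mul_smul]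
      simp only [e] at hx ⊢
      rw [ofForm_smul_left (left_ne_zero_of_smul hx)]
      exact h1 _ hξ hu
  comb_right u ξ η a b hu hv h1 h2 := by
    intro hx hξ h
    by_cases hξ0 : ξ = 0
    · subst hξ0
      have e : a • (0 : Module.Dual F V) + b • η = b • η := by simp
      simp only [e] at hξ ⊢
      rw [ofForm_smul_right (left_ne_zero_of_smul hξ)]
      exact h2 hx _ hv
    by_cases hind : LinearIndependent F ![ξ, η]
    · obtain ⟨l, hl, hmem⟩ := exists_line_right hx hu hv hind
      have hη0 : η ≠ 0 := hind.ne_zero 1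
      refine ε.apply_eq_zero_of_mem_line hf φ hl (x := ofForm u ξ hx hξ0 hu)
        (y := ofForm u η hx hη0 hv) ?_ ?_ (hmem a b hξ h)
        (ofForm_ne_right hx hξ0 hη0 hu hv hind) (h1 _ _ _) (h2 _ _ _)
      · simpa using hmem 1 0 (by simpa using hξ0) (by simpa using hu)
      · simpa using hmem 0 1 (by simpa using hη0) (by simpa using hv)
    · rw [LinearIndependent.pair_iff' hξ0] at hind
      push Not at hind
      obtain ⟨c, rfl⟩ := hind
      have e : a • ξ + b • c • ξ = (a + b * c) • ξ := by rw [add_smul, mul_smul]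
      simp only [e] at hξ ⊢
      rw [ofForm_smul_right (left_ne_zero_of_smul hξ)]
      exact h1 hx _ hu
  meet ξ u v hu hv := by
    by_cases hξ : ξ = 0
    · exact ⟨1, 0, by simp, fun _ h => absurd hξ h⟩
    by_cases hu0 : u = 0
    · exact ⟨1, 0, by simp, fun h => absurd (by simp [hu0]) h⟩
    by_cases hind : LinearIndependent F ![u, v]
    · obtain ⟨l, hl, -, hrep⟩ := exists_line_left hξ hu hv hind
      obtain ⟨z, hz, hz0⟩ := ε.exists_zero hf φ hl
      obtain ⟨a, b, hx, h, rfl⟩ := hrep z hz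
      refine ⟨a, b, ?_, fun _ _ _ => hz0⟩
      by_contra! hab
      simp [hab] at hx
    · rw [LinearIndependent.pair_iff' hu0] at hind
      push Not at hind
      obtain ⟨c, rfl⟩ := hind
      -- For dependent vectors the combination is zero, hence vacuously related.
      exact ⟨c, -1, by simp, fun h => absurd (by simp) h⟩

/-- If the zeros of `φ` are zeros of `ψ`, the ratio of `ψ` to `φ` is constant. -/
theorem ratio_eq_of_zeros_subset {φ ψ : Module.Dual K W}
    (h0 : ∀ x, φ (f x) = 0 → ψ (f x) = 0)
    (hS : ∀ (h h' : Module.Dual F V) (a : V), ∃ b, h b = 0 ∧ h' b = 0 ∧ b ≠ 0 ∧ b ≠ a)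
    {x y : PointHyperplanePair F V} (hx : φ (f x) ≠ 0) (hy : φ (f y) ≠ 0) :
    ψ (f x) / φ (f x) = ψ (f y) / φ (f y) := by
  obtain ⟨p, h, hp, hh, hph, rfl⟩ := exists_eq_ofForm x
  obtain ⟨p', h', hp', hh', hph', rfl⟩ := exists_eq_ofForm y
  -- The colour is the truth value of having the same ratio as `(p', h')`; it is true at `(p', h')`
  -- itself, so equal colours give equal ratios.
  let κ (u : V) (ξ : Module.Dual F V) : Prop := ∀ hu hξ h,
    ψ (f (ofForm u ξ hu hξ h)) / φ (f (ofForm u ξ hu hξ h)) =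
      ψ (f (ofForm p' h' hp' hh' hph')) / φ (f (ofForm p' h' hp' hh' hph'))
  have hκ : κ p h = κ p' h' := by
    refine (ε.isIncidenceHyperplane hf φ).colour_eq ?_ ?_ (fun h h' a _ _ => hS h h' a) hph hph'
      (fun h1 => hx (h1 _ _ _)) (fun h1 => hy (h1 _ _ _))
    · intro ξ u v h1 h2 h3 h4
      push Not at h3 h4
      obtain ⟨hu, hξ, _, h3⟩ := h3
      obtain ⟨hv, _, _, h4⟩ := h4
      have e : ψ (f (ofForm u ξ hu hξ h1)) / φ (f (ofForm u ξ hu hξ h1)) =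
          ψ (f (ofForm v ξ hv hξ h2)) / φ (f (ofForm v ξ hv hξ h2)) := by
        by_cases hind : LinearIndependent F ![u, v]
        · obtain ⟨l, hl, hmem, -⟩ := exists_line_left hξ h1 h2 hind
          refine ε.ratio_eq hf h0 hl ?_ ?_ h3 h4
          · simpa using hmem 1 0 (by simpa using hu) (by simpa using h1)
          · simpa using hmem 0 1 (by simpa using hv) (by simpa using h2)
        · rw [LinearIndependent.pair_iff' hu] at hind
          push Not at hind
          obtain ⟨c, rfl⟩ := hind
          rw [ofForm_smul_left (left_ne_zero_of_smul hv)]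
      exact propext ⟨fun H _ _ _ => e.symm.trans (H _ _ _), fun H _ _ _ => e.trans (H _ _ _)⟩
    · intro u ξ η h1 h2 h3 h4
      push Not at h3 h4
      obtain ⟨hu, hξ, _, h3⟩ := h3
      obtain ⟨_, hη, _, h4⟩ := h4
      have e : ψ (f (ofForm u ξ hu hξ h1)) / φ (f (ofForm u ξ hu hξ h1)) =
          ψ (f (ofForm u η hu hη h2)) / φ (f (ofForm u η hu hη h2)) := by
        by_cases hind : LinearIndependent F ![ξ, η]
        · obtain ⟨l, hl, hmem⟩ := exists_line_right hu h1 h2 hind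
          refine ε.ratio_eq hf h0 hl ?_ ?_ h3 h4
          · simpa using hmem 1 0 (by simpa using hξ) (by simpa using h1)
          · simpa using hmem 0 1 (by simpa using hη) (by simpa using h2)
        · rw [LinearIndependent.pair_iff' hξ] at hind
          push Not at hind
          obtain ⟨c, rfl⟩ := hind
          rw [ofForm_smul_right (left_ne_zero_of_smul hη)]
      exact propext ⟨fun H _ _ _ => e.symm.trans (H _ _ _), fun H _ _ _ => e.trans (H _ _ _)⟩
  exact hκ.mpr (fun _ _ _ => rfl) _ _ _

end ProjectiveEmbedding

end Flags

/-! ### Minimality of the code -/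

theorem proposition4p9 {F V K W : Type*} [Field F] [Finite F] [AddCommGroup V] [Module F V]
    [Field K] [AddCommGroup W] [Module K W]
    (n : ℕ) (hn : 2 ≤ n) (hV : Module.finrank F V = n + 1)
    (hex : ¬ (n = 2 ∧ Nat.card F = 2))
    (ε : ProjectiveEmbedding (pointHyperplaneGeometry F V (by omega)) K W)
    (v : Set.range ε.toFun → W) (hv : IsRepresentativeSystem (Set.range ε.toFun) v) :
    IsMinimalCode (projectiveCode (Set.range ε.toFun) v) := by
  rintro _ ⟨φ, rfl⟩ _ ⟨ψ, rfl⟩ hsupp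
  have h0 (ω : Set.range ε.toFun) (h : φ (v ω) = 0) : ψ (v ω) = 0 := by
    by_contra h1
    exact hsupp (show ω ∈ Function.support _ from h1) h
  let f (x : PointHyperplanePair F V) : W := v ⟨ε.toFun x, Set.mem_range_self x⟩
  by_cases hφ : ∃ x, φ (f x) ≠ 0
  · obtain ⟨x, hx⟩ := hφ
    -- The scalar is the common ratio, read off at any position where the word of `φ` is non-zero.
    refine ⟨ψ (f x) / φ (f x), funext ?_⟩
    rintro ⟨_, y, rfl⟩
    change ψ (f y) = ψ (f x) / φ (f x) * φ (f y)
    by_cases hy : φ (f y) = 0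
    · rw [hy, mul_zero]
      exact h0 _ hy
    · rw [ε.ratio_eq_of_zeros_subset (f := f) (fun x => hv _) (fun x => h0 _)
        (exists_mem_inf_ker_ne hn hV hex) hx hy, div_mul_cancel₀ _ hy]
  -- If the word of `φ` is zero, so is that of `ψ`.
  · push Not at hφ
    refine ⟨0, funext ?_⟩
    rintro ⟨_, y, rfl⟩
    rw [zero_smul]
    exact h0 _ (hφ y)
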